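/- Let $n\ge 0$ be an integer and let $\mathcal X=\mathcal C^1([0,1],\mathbb R^{n\times n})$ with the norm $\max(\|\mathcal A\|_\infty,\|\mathcal A'\|_\infty)$ (the matrix norm is immaterial; here it is the operator norm). For $\theta=(\mathcal A_s)_{s\in[0,1]}\in\mathcal X$ let $s\mapsto Z_s[\theta]\in\mathbb R^{n\times n}$ be the unique solution on $[0,1]$ of $$\frac{\mathrm d}{\mathrm ds}Z_s=\mathcal A_sZ_s,\qquad Z_0=I_n,$$ and for $s\in[0,1]$ put $$\mathbf h_s(\theta)=\mathcal A_s'+\mathcal A_s'^{\top}+[\mathcal A_s^\top,\mathcal A_s],\qquad \mathcal A_s'=\tfrac{\mathrm d}{\mathrm ds}\mathcal A_s .$$ Let $f\in\mathcal C^1(\mathbb R^{n\times n},\mathbb R)$, let $\nabla f$ be its gradient for $\langle U,V\rangle=\operatorname{tr}(U^\top V)$, and let $\ell(\theta)=f(Z_1[\theta])$. Write $\bigl(\frac{\partial\ell}{\partial\mathcal A_s}(\theta)\bigr)_{s\in[0,1]}\in\mathcal X$ for the $L^2$-gradient of $\ell$, i.e. the element $g\in\mathcal X$ such that the Fréchet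 differential of $\ell$ at $\theta$ is $\eta\mapsto\int_0^1\operatorname{tr}(g_s^\top\eta_s)\,\mathrm ds$. Let $T\in(0,+\infty]$ and let $\theta(\cdot)=(\mathcal A_s(\cdot))_{s\in[0,1]}:[0,T)\to\mathcal X$ be a solution of the gradient flow $$\frac{\mathrm d}{\mathrm dt}\theta(t)=-\Bigl(\frac{\partial \ell}{\partial\mathcal A_s}(\theta(t))\Bigr)_{s\in[0,1]},\qquad t\in[0,T),$$ the derivative being taken in $\mathcal X$ (for instance the maximal solution, when $\theta\mapsto(\frac{\partial\ell}{\partial\mathcal A_s}(\theta))_s$ is locally Lipschitz on $\mathcal X$). Assume that the initialization is relaxed balanced: there is a continuous $\lambda:[0,1]\to\mathbb R$ with $\mathbf h_s(\theta(0))=\lambda(s)I_n$ for all $s\in[0,1]$. Then $Z_1(t):=Z_1[\theta(t)]$ is differentiable on $[0,T)$ (one-sidedly at $t=0$), and for every $t\in[0,T)$ $$\dot Z_1=-\int_0^1(Z_1Z_1^\top)^{1-s}\,e^{\gamma(s)}\,\nabla f(Z_1)\,(Z_1^\top Z_1)^s\,\mathrm ds,$$ where the integrand is integrable, the real powers are those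 of symmetric positive semidefinite matrices, and $$\gamma(s)=(1-s)\psi_1(1)-\psi_1(1-s)-s\,\psi_2(1)+\psi_2(s),$$ $$\psi_1(s)=\int_0^s\!\int_0^u\lambda(1-v)\,\mathrm dv\,\mathrm du,\qquad \psi_2(s)=\int_0^s\!\int_0^u\lambda(v)\,\mathrm dv\,\mathrm du .$$ In particular, if $\lambda\equiv0$ on $[0,1]$ (balanced case), then $\gamma\equiv0$ on $[0,1]$. -/

import Mathlib

open Set MeasureTheory
open scoped Matrix Matrix.Norms.L2Operator MatrixOrder Topology unitInterval

/-- Real `n × n` matrices; they carry the `ℓ²` operator norm. -/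
abbrev Mat (n : ℕ) := Matrix (Fin n) (Fin n) ℝ

/-- The Banach space `C¹([0,1], ℝⁿˣⁿ)`. A point is a pair `(A, A')` of continuous functions on
`[0,1]` such that `A'` is the derivative of `A` (one-sided at the end points), so it is determined
by `A`. The norm inherited from the product is `max (sup ‖A‖) (sup ‖A'‖)`. -/
def ParamSpace (n : ℕ) : Submodule ℝ (C(I, Mat n) × C(I, Mat n)) where
  carrier := {p | ∀ s : I,
    HasDerivWithinAt (IccExtend (zero_le_one' ℝ) p.1) (p.2 s) (Icc 0 1) s}
  add_mem' := fun hp hq s => (hp s).add (hq s)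
  zero_mem' := fun s => hasDerivWithinAt_const (s : ℝ) (Icc (0 : ℝ) 1) (0 : Mat n)
  smul_mem' := fun c _ hp s => (hp s).const_smul c

/-- The curve `s ↦ A_s` (extended by constants outside `[0,1]`, where it is never used). -/
noncomputable def path {n : ℕ} (θ : ParamSpace n) : ℝ → Mat n :=
  IccExtend (zero_le_one' ℝ) θ.1.1

/-- The derivative `s ↦ A'_s` (extended by constants outside `[0,1]`). -/
noncomputable def pathDeriv {n : ℕ} (θ : ParamSpace n) : ℝ → Mat n :=
  IccExtend (zero_le_one' ℝ) θ.1.2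

theorem continuous_path {n : ℕ} (θ : ParamSpace n) : Continuous (path θ) :=
  θ.1.1.continuous.Icc_extend'

theorem hasDerivWithinAt_path {n : ℕ} (θ : ParamSpace n) {s : ℝ} (hs : s ∈ Icc (0 : ℝ) 1) :
    HasDerivWithinAt (path θ) (pathDeriv θ s) (Icc 0 1) s := by
  have h := θ.2 ⟨s, hs⟩
  rwa [pathDeriv, IccExtend_of_mem _ _ hs]

/-- `Z` solves the state equation `dZ_s/ds = A_s Z_s` on `[0,1]` with `Z_0 = 1`. -/
def IsStateSolution {n : ℕ} (θ : ParamSpace n) (Z : ℝ → Mat n) : Prop :=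
  Z 0 = 1 ∧ ∀ s ∈ Icc (0 : ℝ) 1, HasDerivWithinAt Z (path θ s * Z s) (Icc 0 1) s

/-- The terms of the Peano–Baker series. -/
noncomputable def peanoBaker {n : ℕ} (A : ℝ → Mat n) : ℕ → ℝ → Mat n
  | 0 => fun _ => 1
  | k + 1 => fun s => ∫ u in (0 : ℝ)..s, A u * peanoBaker A k u

theorem continuous_peanoBaker {n : ℕ} {A : ℝ → Mat n} (hA : Continuous A) (k : ℕ) :
    Continuous (peanoBaker A k) := by
  induction k with
  | zero => exact continuous_const
  | succ k ih =>
    exact intervalIntegral.continuous_primitive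
      (fun a b => (hA.mul ih).intervalIntegrable a b) 0

theorem hasDerivAt_peanoBaker {n : ℕ} {A : ℝ → Mat n} (hA : Continuous A) (k : ℕ) (s : ℝ) :
    HasDerivAt (peanoBaker A (k + 1)) (A s * peanoBaker A k s) s :=
  (hA.mul (continuous_peanoBaker hA k)).integral_hasStrictDerivAt 0 s |>.hasDerivAt

theorem norm_peanoBaker_le {n : ℕ} {A : ℝ → Mat n} {K : ℝ} (hK : ∀ s, ‖A s‖ ≤ K) (k : ℕ) (s : ℝ) :
    ‖peanoBaker A k s‖ ≤ (K * |s|) ^ k / k.factorial * ‖(1 : Mat n)‖ := by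
  have hK0 : 0 ≤ K := (norm_nonneg _).trans (hK 0)
  induction k generalizing s with
  | zero => simp [peanoBaker]
  | succ k ih =>
    have hbound : ∀ u, ‖A u * peanoBaker A k u‖ ≤
        K ^ (k + 1) * |u - 0| ^ k / k.factorial * ‖(1 : Mat n)‖ := fun u => by
      refine (norm_mul_le _ _).trans ((mul_le_mul (hK u) (ih u) (norm_nonneg _) hK0).trans
        (le_of_eq ?_))
      rw [sub_zero, mul_pow]; ring
    calc ‖peanoBaker A (k + 1) s‖
        ≤ ∫ u in uIoc (0 : ℝ) s, K ^ (k + 1) * |u - 0| ^ k / k.factorial * ‖(1 : Mat n)‖ := by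
          rw [peanoBaker, intervalIntegral.norm_intervalIntegral_eq]
          exact norm_integral_le_of_norm_le (Continuous.integrableOn_uIoc (by fun_prop))
            (Filter.Eventually.of_forall hbound)
      _ = (K * |s|) ^ (k + 1) / (k + 1).factorial * ‖(1 : Mat n)‖ := by
          rw [integral_mul_const, integral_div, integral_const_mul, integral_pow_abs_sub_uIoc,
            sub_zero, Nat.factorial_succ, mul_pow]
          push_cast
          field_simp

theorem exists_isStateSolution {n : ℕ} (θ : ParamSpace n) : ∃ Z, IsStateSolution θ Z := by
  set A := path θ with hAdef
  have hA : Continuous A := continuous_path θ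
  have hK : ∀ s, ‖A s‖ ≤ ‖θ.1.1‖ := fun s => θ.1.1.norm_coe_le_norm _
  set K := ‖θ.1.1‖
  have hK0 : 0 ≤ K := norm_nonneg _
  have hsum : Summable fun k : ℕ =>
      K * ((K * 2) ^ k / k.factorial * ‖(1 : Mat n)‖) :=
    ((Real.summable_pow_div_factorial (K * 2)).mul_right _).mul_left _
  have hle : ∀ (k : ℕ) (s : ℝ), s ∈ Metric.ball (0 : ℝ) 2 →
      ‖peanoBaker A k s‖ ≤ (K * 2) ^ k / k.factorial * ‖(1 : Mat n)‖ := fun k s hs => by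
    refine (norm_peanoBaker_le hK k s).trans ?_
    have : |s| ≤ 2 := by simpa using (mem_ball_zero_iff.mp hs).le
    gcongr
  have hPsum : ∀ s ∈ Metric.ball (0 : ℝ) 2, Summable fun k => peanoBaker A k s := fun s hs =>
    Summable.of_norm_bounded ((Real.summable_pow_div_factorial (K * 2)).mul_right _)
      (fun k => hle k s hs)
  have hzero : ∀ k, peanoBaker A (k + 1) 0 = 0 := fun k => by simp [peanoBaker]
  have h0 : (0 : ℝ) ∈ Metric.ball (0 : ℝ) 2 := by simp
  have hd : ∀ s ∈ Metric.ball (0 : ℝ) 2,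
      HasDerivAt (fun s => ∑' k, peanoBaker A (k + 1) s) (∑' k, A s * peanoBaker A k s) s :=
    fun s hs => hasDerivAt_tsum_of_isPreconnected hsum Metric.isOpen_ball
      (convex_ball (0 : ℝ) 2).isPreconnected
      (fun k y _ => hasDerivAt_peanoBaker hA k y)
      (fun k y hy => (norm_mul_le _ _).trans
        (mul_le_mul (hK y) (hle k y hy) (norm_nonneg _) hK0))
      h0 (by simp [hzero]) hs
  refine ⟨fun s => 1 + ∑' k, peanoBaker A (k + 1) s, by simp [hzero], fun s hs => ?_⟩
  have hs2 : s ∈ Metric.ball (0 : ℝ) 2 := by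
    rw [mem_ball_zero_iff, Real.norm_eq_abs, abs_lt]
    constructor <;> linarith [hs.1, hs.2]
  have h := ((hd s hs2).const_add 1).hasDerivWithinAt (s := Icc (0 : ℝ) 1)
  have hsplit : (∑' k, A s * peanoBaker A k s) = A s * (1 + ∑' k, peanoBaker A (k + 1) s) := by
    rw [(hPsum s hs2).tsum_mul_left, (hPsum s hs2).tsum_eq_zero_add]
    rfl
  rwa [hsplit] at h

theorem IsStateSolution.eqOn {n : ℕ} {θ : ParamSpace n} {Z W : ℝ → Mat n}
    (hZ : IsStateSolution θ Z) (hW : IsStateSolution θ W) : EqOn Z W (Icc 0 1) := by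
  refine ODE_solution_unique_of_mem_Icc_right (v := fun s X => path θ s * X)
    (s := fun _ => univ) (K := ‖θ.1.1‖₊) (fun s _ => ?_)
    (fun s hs => (hZ.2 s hs).continuousWithinAt)
    (fun s hs => (hZ.2 s ⟨hs.1, hs.2.le⟩).mono_of_mem_nhdsWithin (Icc_mem_nhdsGE_of_mem hs))
    (fun _ _ => mem_univ _)
    (fun s hs => (hW.2 s hs).continuousWithinAt)
    (fun s hs => (hW.2 s ⟨hs.1, hs.2.le⟩).mono_of_mem_nhdsWithin (Icc_mem_nhdsGE_of_mem hs))
    (fun _ _ => mem_univ _) (hZ.1.trans hW.1.symm)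
  refine (LipschitzWith.of_dist_le_mul fun X Y => ?_).lipschitzOnWith
  rw [dist_eq_norm, dist_eq_norm, ← mul_sub]
  exact (norm_mul_le _ _).trans
    (mul_le_mul_of_nonneg_right (θ.1.1.norm_coe_le_norm _) (norm_nonneg _))

/-- `s ↦ Z_s[θ]`, the solution of the state equation (unique on `[0,1]`, and only used there). -/
noncomputable def stateFlow {n : ℕ} (θ : ParamSpace n) : ℝ → Mat n :=
  (exists_isStateSolution θ).choose

theorem isStateSolution_stateFlow {n : ℕ} (θ : ParamSpace n) :
    IsStateSolution θ (stateFlow θ) :=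
  (exists_isStateSolution θ).choose_spec

/-- The loss `ℓ(θ) = f(Z_1[θ])`. -/
noncomputable def loss {n : ℕ} (f : Mat n → ℝ) (θ : ParamSpace n) : ℝ := f (stateFlow θ 1)

/-- The matrix `∇f(M)` of partial derivatives, i.e. the gradient for `⟨U, V⟩ = tr(Uᵀ V)`. -/
noncomputable def matGrad {n : ℕ} (f : Mat n → ℝ) (M : Mat n) : Mat n :=
  Matrix.of fun i j => fderiv ℝ f M (Matrix.single i j 1)

/-- `g = (∂ℓ/∂A_s(θ))_s`: the functional `ℓ` is Fréchet differentiable at `θ`, and `g` represents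
its differential for the inner product `∫₀¹ tr(Uₛᵀ Vₛ) ds`. -/
def HasL2Gradient {n : ℕ} (ℓ : ParamSpace n → ℝ) (θ g : ParamSpace n) : Prop :=
  ∃ D : ParamSpace n →L[ℝ] ℝ, HasFDerivAt ℓ D θ ∧
    ∀ η : ParamSpace n, D η = ∫ s in (0 : ℝ)..1, ((path g s)ᵀ * path η s).trace

/-- The time interval `[0, T)`, with `T = ∞` allowed. -/
def timeInterval (T : EReal) : Set ℝ := {t | 0 ≤ t ∧ (t : EReal) < T}

/-- `θ` is a gradient flow trajectory of `ℓ` on `[0, T)`: for each `t`, the derivative of `θ` at `t`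
in `C¹([0,1], ℝⁿˣⁿ)` is `-(∂ℓ/∂A_s(θ(t)))_s`. -/
def IsGradientFlow {n : ℕ} (ℓ : ParamSpace n → ℝ) (T : EReal) (θ : ℝ → ParamSpace n) : Prop :=
  ∀ t ∈ timeInterval T, ∃ g : ParamSpace n, HasL2Gradient ℓ (θ t) g ∧
    HasDerivWithinAt θ (-g) (timeInterval T) t

/-- `h_s(θ) = A'_s + A'_sᵀ + [A_sᵀ, A_s]`. -/
noncomputable def conserved {n : ℕ} (s : ℝ) (θ : ParamSpace n) : Mat n :=
  pathDeriv θ s + (pathDeriv θ s)ᵀ + ⁅(path θ s)ᵀ, path θ s⁆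

/-- `ψ₁(s) = ∫₀ˢ ∫₀ᵘ lam(1 - v) dv du`. -/
noncomputable def psi₁ (lam : ℝ → ℝ) (s : ℝ) : ℝ :=
  ∫ u in (0 : ℝ)..s, ∫ v in (0 : ℝ)..u, lam (1 - v)

/-- `ψ₂(s) = ∫₀ˢ ∫₀ᵘ lam(v) dv du`. -/
noncomputable def psi₂ (lam : ℝ → ℝ) (s : ℝ) : ℝ :=
  ∫ u in (0 : ℝ)..s, ∫ v in (0 : ℝ)..u, lam v

/-- `γ(s) = (1 - s) ψ₁(1) - ψ₁(1 - s) - s ψ₂(1) + ψ₂(s)`. -/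
noncomputable def gammaExponent (lam : ℝ → ℝ) (s : ℝ) : ℝ :=
  (1 - s) * psi₁ lam 1 - psi₁ lam (1 - s) - s * psi₂ lam 1 + psi₂ lam s

/-- The integrand `(Z Zᵀ)^(1-s) exp(γ(s)) ∇f(Z) (Zᵀ Z)^s`, where the real powers of the positive
semidefinite matrices `Z Zᵀ` and `Zᵀ Z` are those of the continuous functional calculus. -/
noncomputable def intrinsicIntegrand {n : ℕ} (f : Mat n → ℝ) (lam : ℝ → ℝ) (Z : Mat n) (s : ℝ) :
    Mat n :=
  Real.exp (gammaExponent lam s) • ((Z * Zᵀ) ^ (1 - s) * matGrad f Z * (Zᵀ * Z) ^ s)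

/-! By Duhamel's formula the differential of `θ ↦ Z_1[θ]` is `η ↦ Z_1 ∫ Z_s⁻¹ η_s Z_s ds`, so with
`G = ∇f(Z_1)` the gradient of the loss must be `g_s = Z_s⁻ᵀ Z_1ᵀ G Z_sᵀ`. This curve satisfies the
Lax equation `g' = [g, Aᵀ]`, which is exactly what makes every `h_s` constant in time
(`IsGradientFlow.conserved_eq`); relaxed balancedness therefore persists.

At a fixed time, `h_s = λ(s) I` reads `(A + Aᵀ)' = λ I + [A, A + Aᵀ]`. Conjugation by the flow
removes the commutator: `Z_s⁻¹ (A_s + A_sᵀ) Z_s = S + ∫₀ˢ λ`, with `S = A_0 + A_0ᵀ`. Hence `(ZᵀZ)' =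
ZᵀZ (S + ∫λ)`, and `Z_sᵀ Z_s = e^{ψ₂(s)} exp(sS)` (`transpose_stateFlow_mul_stateFlow`).

Thus `Z_sᵀ Z_s` is, up to a positive scalar, the power `(Z_1ᵀ Z_1)^s`, and `Z_1 Z_s⁻¹ Z_s⁻ᵀ Z_1ᵀ`
is, up to the inverse scalar, `(Z_1 Z_1ᵀ)^(1-s)`. The scalars cancel in the integrand of `Ż_1 = -Z_1
∫ Z_s⁻¹ g_s Z_s ds`. The factor `e^γ` is harmless because `γ` is affine and vanishes at both ends,
hence is zero (`gammaExponent_eq_zero`). -/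

/-! ### Calculus on the parameter space. -/

theorem HasDerivWithinAt.transpose_mat {n : ℕ} {F : ℝ → Mat n} {F' : Mat n} {S : Set ℝ} {s : ℝ}
    (h : HasDerivWithinAt F F' S s) : HasDerivWithinAt (fun u => (F u)ᵀ) F'ᵀ S s := by
  simpa only [Matrix.star_eq_conjTranspose, Matrix.conjTranspose_eq_transpose_of_trivial]
    using h.star

theorem eq_of_hasDerivWithinAt_zero {E : Type*} [NormedAddCommGroup E] [NormedSpace ℝ E]
    {F : ℝ → E} {S : Set ℝ} (hS : Convex ℝ S) (hF : ∀ s ∈ S, HasDerivWithinAt F 0 S s)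
    {x y : ℝ} (hx : x ∈ S) (hy : y ∈ S) : F y = F x := by
  have h := hS.norm_image_sub_le_of_norm_hasDerivWithin_le (C := 0) hF (by simp) hx hy
  rw [zero_mul] at h
  exact sub_eq_zero.mp (norm_le_zero_iff.mp h)

/-- An element of the parameter space from a curve with a continuous derivative on `[0,1]`. -/
noncomputable def ParamSpace.ofDeriv {n : ℕ} (F F' : ℝ → Mat n)
    (hF : ∀ s ∈ Icc (0 : ℝ) 1, HasDerivWithinAt F (F' s) (Icc 0 1) s)
    (hF' : ContinuousOn F' (Icc 0 1)) : ParamSpace n :=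
  ⟨(⟨fun s => F s, (show ContinuousOn F (Icc 0 1) from
      fun s hs => (hF s hs).continuousWithinAt).domRestrict⟩,
    ⟨fun s => F' s, hF'.domRestrict⟩), fun s =>
      (hF s s.2).congr_of_mem (fun x hx => by rw [IccExtend_of_mem _ _ hx]; rfl) s.2⟩

theorem path_ofDeriv {n : ℕ} {F F' : ℝ → Mat n}
    (hF : ∀ s ∈ Icc (0 : ℝ) 1, HasDerivWithinAt F (F' s) (Icc 0 1) s)
    (hF' : ContinuousOn F' (Icc 0 1)) {s : ℝ} (hs : s ∈ Icc (0 : ℝ) 1) :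
    path (ParamSpace.ofDeriv F F' hF hF') s = F s := by
  rw [path, IccExtend_of_mem _ _ hs]; rfl

theorem pathDeriv_ofDeriv {n : ℕ} {F F' : ℝ → Mat n}
    (hF : ∀ s ∈ Icc (0 : ℝ) 1, HasDerivWithinAt F (F' s) (Icc 0 1) s)
    (hF' : ContinuousOn F' (Icc 0 1)) {s : ℝ} (hs : s ∈ Icc (0 : ℝ) 1) :
    pathDeriv (ParamSpace.ofDeriv F F' hF hF') s = F' s := by
  rw [pathDeriv, IccExtend_of_mem _ _ hs]; rfl

theorem continuous_pathDeriv {n : ℕ} (θ : ParamSpace n) : Continuous (pathDeriv θ) :=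
  θ.1.2.continuous.Icc_extend'

/-- Evaluation `θ ↦ A_s` as a continuous linear map. -/
noncomputable def pathCLM {n : ℕ} (s : ℝ) : ParamSpace n →L[ℝ] Mat n :=
  (ContinuousMap.evalCLM ℝ (projIcc 0 1 (zero_le_one' ℝ) s)).comp
    ((ContinuousLinearMap.fst ℝ C(I, Mat n) C(I, Mat n)).comp (ParamSpace n).subtypeL)

/-- Evaluation `θ ↦ A'_s` as a continuous linear map. -/
noncomputable def pathDerivCLM {n : ℕ} (s : ℝ) : ParamSpace n →L[ℝ] Mat n :=
  (ContinuousMap.evalCLM ℝ (projIcc 0 1 (zero_le_one' ℝ) s)).comp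
    ((ContinuousLinearMap.snd ℝ C(I, Mat n) C(I, Mat n)).comp (ParamSpace n).subtypeL)

theorem path_add {n : ℕ} (θ η : ParamSpace n) (s : ℝ) :
    path (θ + η) s = path θ s + path η s := rfl

theorem path_sub {n : ℕ} (θ η : ParamSpace n) (s : ℝ) :
    path (θ - η) s = path θ s - path η s := rfl

theorem path_smul {n : ℕ} (c : ℝ) (θ : ParamSpace n) (s : ℝ) :
    path (c • θ) s = c • path θ s := rfl

theorem norm_path_le {n : ℕ} (θ : ParamSpace n) (s : ℝ) : ‖path θ s‖ ≤ ‖θ‖ :=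
  (θ.1.1.norm_coe_le_norm _).trans (norm_fst_le θ.1)

/-- Derivatives within `[0,1]` are unique, so the second component is recovered from the first. -/
theorem ParamSpace.ext_path {n : ℕ} {θ η : ParamSpace n}
    (h : ∀ s ∈ Icc (0 : ℝ) 1, path θ s = path η s) : θ = η := by
  have h1 : ∀ s : I, θ.1.1 s = η.1.1 s := fun s => by
    simpa only [path, IccExtend_of_mem _ _ s.2] using h s s.2
  refine Subtype.ext (Prod.ext (ContinuousMap.ext h1) (ContinuousMap.ext fun s => ?_))
  have h2 : θ.1.1 = η.1.1 := ContinuousMap.ext h1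
  have hη := η.2 s
  rw [← h2] at hη
  exact (uniqueDiffOn_Icc_zero_one s s.2).eq_deriv _ (θ.2 s) hη

/-! ### The inverse flow, Duhamel's formula and Lipschitz dependence. -/

/-- The parameter `s ↦ -A_sᵀ` of the adjoint equation. -/
noncomputable def adjointParam {n : ℕ} (θ : ParamSpace n) : ParamSpace n :=
  ParamSpace.ofDeriv (fun s => -(path θ s)ᵀ) (fun s => -(pathDeriv θ s)ᵀ)
    (fun _ hs => (hasDerivWithinAt_path θ hs).transpose_mat.neg)
    (continuous_pathDeriv θ).matrix_transpose.neg.continuousOn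

/-- `s ↦ Z_s[θ]⁻¹` on `[0,1]`. -/
noncomputable def stateInv {n : ℕ} (θ : ParamSpace n) (s : ℝ) : Mat n :=
  (stateFlow (adjointParam θ) s)ᵀ

theorem stateFlow_zero {n : ℕ} (θ : ParamSpace n) : stateFlow θ 0 = 1 :=
  (isStateSolution_stateFlow θ).1

theorem hasDerivWithinAt_stateFlow {n : ℕ} (θ : ParamSpace n) {s : ℝ} (hs : s ∈ Icc (0 : ℝ) 1) :
    HasDerivWithinAt (stateFlow θ) (path θ s * stateFlow θ s) (Icc 0 1) s :=
  (isStateSolution_stateFlow θ).2 s hs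

theorem stateInv_zero {n : ℕ} (θ : ParamSpace n) : stateInv θ 0 = 1 := by
  rw [stateInv, stateFlow_zero, Matrix.transpose_one]

theorem hasDerivWithinAt_stateInv {n : ℕ} (θ : ParamSpace n) {s : ℝ} (hs : s ∈ Icc (0 : ℝ) 1) :
    HasDerivWithinAt (stateInv θ) (-(stateInv θ s * path θ s)) (Icc 0 1) s := by
  have h := (hasDerivWithinAt_stateFlow (adjointParam θ) hs).transpose_mat
  rw [adjointParam, path_ofDeriv _ _ hs, Matrix.transpose_mul, Matrix.transpose_neg,
    Matrix.transpose_transpose, mul_neg] at h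
  exact h

theorem continuousOn_stateFlow {n : ℕ} (θ : ParamSpace n) :
    ContinuousOn (stateFlow θ) (Icc 0 1) :=
  fun _ hs => (hasDerivWithinAt_stateFlow θ hs).continuousWithinAt

theorem continuousOn_stateInv {n : ℕ} (θ : ParamSpace n) :
    ContinuousOn (stateInv θ) (Icc 0 1) :=
  fun _ hs => (hasDerivWithinAt_stateInv θ hs).continuousWithinAt

/-- Used twice: `φ = θ` gives a constant product, hence the inverse; general `φ` integrates to
Duhamel's formula. -/
theorem hasDerivWithinAt_stateInv_mul {n : ℕ} (θ φ : ParamSpace n) {s : ℝ}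
    (hs : s ∈ Icc (0 : ℝ) 1) :
    HasDerivWithinAt (fun u => stateInv θ u * stateFlow φ u)
      (stateInv θ s * path (φ - θ) s * stateFlow φ s) (Icc 0 1) s := by
  refine ((hasDerivWithinAt_stateInv θ hs).mul
    (hasDerivWithinAt_stateFlow φ hs)).congr_deriv ?_
  rw [path_sub]; noncomm_ring

theorem stateInv_mul_stateFlow {n : ℕ} (θ : ParamSpace n) {s : ℝ} (hs : s ∈ Icc (0 : ℝ) 1) :
    stateInv θ s * stateFlow θ s = 1 := by
  have h := eq_of_hasDerivWithinAt_zero (convex_Icc (0 : ℝ) 1)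
    (F := fun u => stateInv θ u * stateFlow θ u)
    (fun u hu => (hasDerivWithinAt_stateInv_mul θ θ hu).congr_deriv
      (by rw [path_sub, sub_self, mul_zero, zero_mul]))
    (left_mem_Icc.mpr zero_le_one) hs
  simpa only [stateFlow_zero, stateInv_zero, mul_one] using h

theorem stateFlow_mul_stateInv {n : ℕ} (θ : ParamSpace n) {s : ℝ} (hs : s ∈ Icc (0 : ℝ) 1) :
    stateFlow θ s * stateInv θ s = 1 :=
  mul_eq_one_comm.mp (stateInv_mul_stateFlow θ hs)

theorem intervalIntegrable_of_continuousOn_unit {E : Type*} [NormedAddCommGroup E]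
    {F : ℝ → E} (h : ContinuousOn F (Icc 0 1)) : IntervalIntegrable F volume 0 1 :=
  ContinuousOn.intervalIntegrable (by rwa [uIcc_of_le zero_le_one])

/-- Duhamel's formula for the end point. -/
theorem stateFlow_one_sub {n : ℕ} (θ φ : ParamSpace n) :
    stateFlow φ 1 - stateFlow θ 1 = stateFlow θ 1 *
      ∫ s in (0 : ℝ)..1, stateInv θ s * path (φ - θ) s * stateFlow φ s := by
  have hc : ContinuousOn (fun s => stateInv θ s * path (φ - θ) s * stateFlow φ s) (Icc 0 1) :=
    ((continuousOn_stateInv θ).mul (continuous_path _).continuousOn).mul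
      (continuousOn_stateFlow φ)
  rw [intervalIntegral.integral_eq_sub_of_hasDeriv_right_of_le zero_le_one
    (f := fun u => stateInv θ u * stateFlow φ u)
    ((continuousOn_stateInv θ).mul (continuousOn_stateFlow φ))
    (fun s hs => ((hasDerivWithinAt_stateInv_mul θ φ (Ioo_subset_Icc_self hs)).hasDerivAt
      (Icc_mem_nhds hs.1 hs.2)).hasDerivWithinAt)
    (intervalIntegrable_of_continuousOn_unit hc)]
  simp only [stateFlow_zero, stateInv_zero, mul_one, mul_sub, ← mul_assoc,
    stateFlow_mul_stateInv θ (right_mem_Icc.mpr zero_le_one), one_mul]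

/-- Grönwall: the difference of the two flows starts at zero and solves a linear equation with
forcing `(A^φ - A^θ) Z^θ`. -/
theorem exists_norm_stateFlow_sub_le {n : ℕ} (θ : ParamSpace n) :
    ∃ C : ℝ, ∀ φ : ParamSpace n, ‖φ - θ‖ ≤ 1 → ∀ s ∈ Icc (0 : ℝ) 1,
      ‖stateFlow φ s - stateFlow θ s‖ ≤ C * ‖φ - θ‖ := by
  obtain ⟨M, hM⟩ := isCompact_Icc.exists_bound_of_continuousOn (continuousOn_stateFlow θ)
  have hM0 : 0 ≤ M := (norm_nonneg _).trans (hM 0 (left_mem_Icc.mpr zero_le_one))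
  -- Bounds `‖φ‖` on the unit ball around `θ`; the `+ 1` also makes `K` nonzero, as the explicit
  -- Grönwall bound requires.
  set K : ℝ := ‖θ‖ + 1 with hK
  have hK0 : 0 < K := by positivity
  have hd : ∀ φ : ParamSpace n, ∀ s ∈ Icc (0 : ℝ) 1,
      HasDerivWithinAt (fun u => stateFlow φ u - stateFlow θ u)
        (path φ s * (stateFlow φ s - stateFlow θ s) + path (φ - θ) s * stateFlow θ s)
        (Icc 0 1) s := fun φ s hs =>
    ((hasDerivWithinAt_stateFlow φ hs).sub (hasDerivWithinAt_stateFlow θ hs)).congr_deriv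
      (by rw [path_sub]; noncomm_ring)
  refine ⟨M / K * Real.exp K, fun φ hφ s hs => ?_⟩
  have hφK : ‖φ‖ ≤ K := by
    have := norm_add_le (φ - θ) θ
    rw [sub_add_cancel] at this
    linarith
  have hb := norm_le_gronwallBound_of_norm_deriv_right_le (δ := 0) (K := K) (ε := ‖φ - θ‖ * M)
    (fun u hu => (hd φ u hu).continuousWithinAt)
    (fun u hu => (hd φ u ⟨hu.1, hu.2.le⟩).mono_of_mem_nhdsWithin (Icc_mem_nhdsGE_of_mem hu))
    (by simp [stateFlow_zero])
    (fun u hu => (norm_add_le _ _).trans (add_le_add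
      ((norm_mul_le _ _).trans (mul_le_mul_of_nonneg_right
        ((norm_path_le φ u).trans hφK) (norm_nonneg _)))
      ((norm_mul_le _ _).trans (mul_le_mul (norm_path_le _ u) (hM u ⟨hu.1, hu.2.le⟩)
        (norm_nonneg _) (norm_nonneg _))))) s hs
  refine hb.trans ?_
  simp only [gronwallBound_of_K_ne_0 hK0.ne', zero_mul, zero_add, sub_zero]
  have he : Real.exp (K * s) - 1 ≤ Real.exp K := by
    have : Real.exp (K * s) ≤ Real.exp K :=
      Real.exp_le_exp.mpr (mul_le_of_le_one_right hK0.le hs.2)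
    linarith
  calc ‖φ - θ‖ * M / K * (Real.exp (K * s) - 1)
      ≤ ‖φ - θ‖ * M / K * Real.exp K := by gcongr
    _ = M / K * Real.exp K * ‖φ - θ‖ := by ring

/-! ### Powers of exponentials and the matrix gradient. -/

/-- Both sides are functional calculi of `H`, where the scalar identity is `(e^x)^r = e^(r x)`. -/
theorem rpow_exp {n : ℕ} {H : Mat n} (hH : IsSelfAdjoint H) (r : ℝ) :
    (NormedSpace.exp H) ^ r = NormedSpace.exp (r • H) := by
  have hrH : IsSelfAdjoint (r • H) := IsSelfAdjoint.smul (IsSelfAdjoint.all r) hH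
  rw [CFC.rpow_eq_cfc_real hH.exp_nonneg, ← CFC.real_exp_eq_normedSpace_exp hH,
    ← CFC.real_exp_eq_normedSpace_exp hrH, ← cfc_comp_smul r Real.exp H,
    ← cfc_comp' (fun x : ℝ => x ^ r) Real.exp H]
  refine cfc_congr fun x _ => ?_
  simp only [← Real.exp_mul, smul_eq_mul, mul_comm]

theorem fderiv_apply_eq_trace {n : ℕ} (f : Mat n → ℝ) (M H : Mat n) :
    fderiv ℝ f M H = ((matGrad f M)ᵀ * H).trace := by
  conv_lhs => rw [Matrix.matrix_eq_sum_single H]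
  have : ∀ i j, Matrix.single i j (H i j) = H i j • Matrix.single i j (1 : ℝ) := by simp
  simp only [map_sum, this, map_smul, smul_eq_mul, Matrix.trace, Matrix.diag_apply,
    Matrix.mul_apply, Matrix.transpose_apply, matGrad, Matrix.of_apply]
  rw [Finset.sum_comm]
  simp only [mul_comm]

/-! ### Vanishing of the exponent `γ`. -/

theorem psi₂_congr {lam L : ℝ → ℝ} (h : EqOn lam L (Icc 0 1)) {s : ℝ} (hs : s ∈ Icc (0 : ℝ) 1) :
    psi₂ lam s = psi₂ L s := by
  refine intervalIntegral.integral_congr fun u hu => intervalIntegral.integral_congr fun v hv => ?_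
  rw [uIcc_of_le hs.1] at hu
  rw [uIcc_of_le hu.1] at hv
  exact h ⟨hv.1, hv.2.trans (hu.2.trans hs.2)⟩

theorem psi₁_eq (lam : ℝ → ℝ) : psi₁ lam = psi₂ fun v => lam (1 - v) := rfl

theorem gammaExponent_congr {lam L : ℝ → ℝ} (h : EqOn lam L (Icc 0 1)) {s : ℝ}
    (hs : s ∈ Icc (0 : ℝ) 1) : gammaExponent lam s = gammaExponent L s := by
  have h' : EqOn (fun v => lam (1 - v)) (fun v => L (1 - v)) (Icc 0 1) :=
    fun v hv => h (Set.Icc.mem_iff_one_sub_mem.mp hv)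
  have h1 : (1 : ℝ) ∈ Icc (0 : ℝ) 1 := right_mem_Icc.mpr zero_le_one
  rw [gammaExponent, gammaExponent, psi₁_eq, psi₁_eq, psi₂_congr h hs, psi₂_congr h h1,
    psi₂_congr h' h1, psi₂_congr h' (Set.Icc.mem_iff_one_sub_mem.mp hs)]

theorem hasDerivAt_primitive {L : ℝ → ℝ} (hL : Continuous L) (s : ℝ) :
    HasDerivAt (fun u => ∫ v in (0 : ℝ)..u, L v) (L s) s :=
  (hL.integral_hasStrictDerivAt 0 s).hasDerivAt

theorem hasDerivAt_psi₂ {L : ℝ → ℝ} (hL : Continuous L) (s : ℝ) :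
    HasDerivAt (psi₂ L) (∫ v in (0 : ℝ)..s, L v) s :=
  hasDerivAt_primitive (intervalIntegral.continuous_primitive
    (fun a b => hL.intervalIntegrable a b) 0) s

theorem psi₂_zero (L : ℝ → ℝ) : psi₂ L 0 = 0 := intervalIntegral.integral_same

/-- The exponent `γ` vanishes on `[0,1]` for every continuous `lam`. -/
theorem gammaExponent_eq_zero {lam : ℝ → ℝ} (hlam : ContinuousOn lam (Icc 0 1)) {s : ℝ}
    (hs : s ∈ Icc (0 : ℝ) 1) : gammaExponent lam s = 0 := by
  -- Extending by constants makes the primitives differentiable on all of `ℝ`, without changing `γ`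
  -- on `[0,1]`.
  set L : ℝ → ℝ := IccExtend (zero_le_one' ℝ) ((Icc 0 1).domRestrict lam) with hLdef
  have hL : Continuous L := hlam.domRestrict.Icc_extend'
  have hL' : Continuous fun v => L (1 - v) := by fun_prop
  have hEq : EqOn lam L (Icc 0 1) := fun v hv => by
    rw [hLdef, IccExtend_of_mem _ _ hv]; rfl
  rw [gammaExponent_congr hEq hs]
  -- This is `γ'(u)` for every `u`: the substitution `v ↦ 1 - v` turns the `ψ₁` term into `∫_u^1 L`,
  -- which completes `∫_0^u L` from `ψ₂`. So `γ` is affine, and `γ(0) = γ(1) = 0` finishes.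
  set c : ℝ := -psi₁ L 1 - psi₂ L 1 + ∫ v in (0 : ℝ)..1, L v with hc
  have hd : ∀ u : ℝ, HasDerivAt (fun u => gammaExponent L u - c * u) 0 u := fun u => by
    have h1 := (hasDerivAt_psi₂ hL' (1 - u)).comp_const_sub 1 u
    have h2 := hasDerivAt_psi₂ hL u
    have h3 : ∫ v in (0 : ℝ)..(1 - u), L (1 - v) = ∫ v in u..1, L v := by
      rw [intervalIntegral.integral_comp_sub_left]; simp
    have h4 := intervalIntegral.integral_add_adjacent_intervals
      (hL.intervalIntegrable (μ := volume) 0 u) (hL.intervalIntegrable u 1)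
    have h5 := (((((hasDerivAt_id u).const_sub 1).mul_const (psi₁ L 1)).sub h1).sub
      ((hasDerivAt_id u).mul_const (psi₂ L 1))).add h2 |>.sub ((hasDerivAt_id u).const_mul c)
    refine h5.congr_deriv ?_
    rw [h3, hc, ← h4]; ring
  have hconst : ∀ u, gammaExponent L u - c * u = gammaExponent L 0 - c * 0 := fun u =>
    is_const_of_deriv_eq_zero (fun u => (hd u).differentiableAt) (fun u => (hd u).deriv) u 0
  have h0 : gammaExponent L 0 = 0 := by simp [gammaExponent, psi₂_zero]
  have h1 : gammaExponent L 1 = 0 := by simp [gammaExponent, psi₁_eq, psi₂_zero]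
  have hc0 : c = 0 := by
    have := hconst 1
    rw [h0, h1] at this
    linarith
  have := hconst s
  rw [h0, hc0] at this
  linarith

/-! ### Fréchet differentiability of the end point map. -/

theorem continuousOn_sensitivity {n : ℕ} (θ η φ : ParamSpace n) :
    ContinuousOn (fun s => stateInv θ s * path η s * stateFlow φ s) (Icc 0 1) :=
  ((continuousOn_stateInv θ).mul (continuous_path _).continuousOn).mul (continuousOn_stateFlow φ)

/-- The differential `η ↦ Z_1 ∫₀¹ Z_s⁻¹ η_s Z_s ds` of `θ ↦ Z_1[θ]`. -/
noncomputable def endpointLinear {n : ℕ} (θ : ParamSpace n) : ParamSpace n →ₗ[ℝ] Mat n where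
  toFun η := stateFlow θ 1 * ∫ s in (0 : ℝ)..1, stateInv θ s * path η s * stateFlow θ s
  map_add' η ζ := by
    rw [← mul_add, ← intervalIntegral.integral_add
      (intervalIntegrable_of_continuousOn_unit (continuousOn_sensitivity θ η θ))
      (intervalIntegrable_of_continuousOn_unit (continuousOn_sensitivity θ ζ θ))]
    simp only [path_add, mul_add, add_mul]
  map_smul' c η := by
    simp only [path_smul, mul_smul_comm, smul_mul_assoc, intervalIntegral.integral_smul,
      RingHom.id_apply]

theorem exists_norm_stateFlow_le {n : ℕ} (θ : ParamSpace n) :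
    ∃ M : ℝ, 0 ≤ M ∧ ∀ s ∈ Icc (0 : ℝ) 1, ‖stateFlow θ s‖ ≤ M ∧ ‖stateInv θ s‖ ≤ M := by
  obtain ⟨M, hM⟩ := isCompact_Icc.exists_bound_of_continuousOn (continuousOn_stateFlow θ)
  obtain ⟨N, hN⟩ := isCompact_Icc.exists_bound_of_continuousOn (continuousOn_stateInv θ)
  exact ⟨max M N, ((norm_nonneg _).trans (hM 0 (left_mem_Icc.mpr zero_le_one))).trans
    (le_max_left _ _), fun s hs =>
      ⟨(hM s hs).trans (le_max_left _ _), (hN s hs).trans (le_max_right _ _)⟩⟩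

theorem norm_sensitivity_integral_le {F G H : ℝ → Mat n} {a b c : ℝ}
    (hF : ∀ s ∈ Icc (0 : ℝ) 1, ‖F s‖ ≤ a) (hG : ∀ s ∈ Icc (0 : ℝ) 1, ‖G s‖ ≤ b)
    (hH : ∀ s ∈ Icc (0 : ℝ) 1, ‖H s‖ ≤ c) :
    ‖∫ s in (0 : ℝ)..1, F s * G s * H s‖ ≤ a * b * c := by
  have h0 : (0 : ℝ) ∈ Icc (0 : ℝ) 1 := left_mem_Icc.mpr zero_le_one
  have ha := (norm_nonneg _).trans (hF 0 h0)
  have hb := (norm_nonneg _).trans (hG 0 h0)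
  refine (intervalIntegral.norm_integral_le_of_norm_le_const fun s hs => ?_).trans
    (le_of_eq (by rw [sub_zero, abs_one, mul_one]))
  rw [uIoc_of_le zero_le_one] at hs
  have hs' := Ioc_subset_Icc_self hs
  exact (norm_mul_le _ _).trans (mul_le_mul ((norm_mul_le _ _).trans
    (mul_le_mul (hF s hs') (hG s hs') (norm_nonneg _) ha)) (hH s hs') (norm_nonneg _)
    (mul_nonneg ha hb))

theorem exists_endpointLinear_bound {n : ℕ} (θ : ParamSpace n) :
    ∃ C : ℝ, ∀ η, ‖endpointLinear θ η‖ ≤ C * ‖η‖ := by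
  obtain ⟨M, hM0, hM⟩ := exists_norm_stateFlow_le θ
  refine ⟨M * (M * M), fun η => (norm_mul_le _ _).trans ?_⟩
  refine (mul_le_mul (hM 1 (right_mem_Icc.mpr zero_le_one)).1
    (norm_sensitivity_integral_le (fun s hs => (hM s hs).2) (fun s _ => norm_path_le η s)
      (fun s hs => (hM s hs).1)) (norm_nonneg _) hM0).trans (le_of_eq (by ring))

/-- `endpointLinear` as a continuous linear map. -/
noncomputable def endpointDeriv {n : ℕ} (θ : ParamSpace n) : ParamSpace n →L[ℝ] Mat n :=
  (endpointLinear θ).mkContinuousOfExistsBound (exists_endpointLinear_bound θ)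

theorem endpointDeriv_apply {n : ℕ} (θ η : ParamSpace n) :
    endpointDeriv θ η =
      stateFlow θ 1 * ∫ s in (0 : ℝ)..1, stateInv θ s * path η s * stateFlow θ s := rfl

theorem hasFDerivAt_of_norm_sub_le_sq {E F : Type*} [NormedAddCommGroup E] [NormedSpace ℝ E]
    [NormedAddCommGroup F] [NormedSpace ℝ F] {f : E → F} {L : E →L[ℝ] F} {x : E} {K : ℝ}
    (h : ∀ y, ‖y - x‖ ≤ 1 → ‖f y - f x - L (y - x)‖ ≤ K * ‖y - x‖ ^ 2) : HasFDerivAt f L x := by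
  have hO : (fun y => f y - f x - L (y - x)) =O[𝓝 x] fun y => ‖y - x‖ ^ 2 := by
    refine Asymptotics.IsBigO.of_bound K ?_
    filter_upwards [Metric.closedBall_mem_nhds x one_pos] with y hy
    rw [mem_closedBall_iff_norm] at hy
    rw [Real.norm_of_nonneg (sq_nonneg _)]
    exact h y hy
  exact HasFDerivAt.of_isLittleO (hO.trans_isLittleO
    ((Asymptotics.isLittleO_norm_pow_id one_lt_two).comp_tendsto
      (tendsto_sub_nhds_zero_iff.mpr (Filter.tendsto_id (x := 𝓝 x)))))

/-- The linear part is Duhamel's integral with `Z^φ` replaced by `Z^θ`. The error integrand contains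
both `φ - θ` and `Z^φ - Z^θ`, each of first order. -/
theorem exists_norm_endpoint_sub_le {n : ℕ} (θ : ParamSpace n) : ∃ K : ℝ, ∀ φ : ParamSpace n,
    ‖φ - θ‖ ≤ 1 →
      ‖stateFlow φ 1 - stateFlow θ 1 - endpointDeriv θ (φ - θ)‖ ≤ K * ‖φ - θ‖ ^ 2 := by
  obtain ⟨M, hM0, hM⟩ := exists_norm_stateFlow_le θ
  obtain ⟨C, hC⟩ := exists_norm_stateFlow_sub_le θ
  refine ⟨M * (M * C), fun φ hφ => ?_⟩
  have he : stateFlow φ 1 - stateFlow θ 1 - endpointDeriv θ (φ - θ) = stateFlow θ 1 *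
      ∫ s in (0 : ℝ)..1, stateInv θ s * path (φ - θ) s * (stateFlow φ s - stateFlow θ s) := by
    rw [stateFlow_one_sub, endpointDeriv_apply, ← mul_sub, ← intervalIntegral.integral_sub
      (intervalIntegrable_of_continuousOn_unit (continuousOn_sensitivity θ _ φ))
      (intervalIntegrable_of_continuousOn_unit (continuousOn_sensitivity θ _ θ))]
    simp only [mul_sub]
  rw [he]
  exact (norm_mul_le _ _).trans ((mul_le_mul (hM 1 (right_mem_Icc.mpr zero_le_one)).1
    (norm_sensitivity_integral_le (fun s hs => (hM s hs).2) (fun s _ => norm_path_le _ s)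
      (hC φ hφ)) (norm_nonneg _) hM0).trans (le_of_eq (by ring)))

theorem hasFDerivAt_endpoint {n : ℕ} (θ : ParamSpace n) :
    HasFDerivAt (fun φ : ParamSpace n => stateFlow φ 1) (endpointDeriv θ) θ :=
  hasFDerivAt_of_norm_sub_le_sq (E := ParamSpace n) (F := Mat n) (exists_norm_endpoint_sub_le θ).choose_spec

/-! ### The `L²`-gradient of the loss. -/

/-- The `L²`-gradient `Z_s⁻ᵀ Z_1ᵀ G Z_sᵀ` for `G = ∇f(Z_1)`, as a curve. -/
noncomputable def gradCurve {n : ℕ} (θ : ParamSpace n) (G : Mat n) (s : ℝ) : Mat n :=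
  (stateInv θ s)ᵀ * ((stateFlow θ 1)ᵀ * G) * (stateFlow θ s)ᵀ

/-- The Lax equation `g' = [g, Aᵀ]`: it places the gradient in `C¹` and is the source of the
conservation law. -/
theorem hasDerivWithinAt_gradCurve {n : ℕ} (θ : ParamSpace n) (G : Mat n) {s : ℝ}
    (hs : s ∈ Icc (0 : ℝ) 1) :
    HasDerivWithinAt (gradCurve θ G)
      (gradCurve θ G s * (path θ s)ᵀ - (path θ s)ᵀ * gradCurve θ G s) (Icc 0 1) s := by
  refine (((hasDerivWithinAt_stateInv θ hs).transpose_mat.mul_const _).mul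
    (hasDerivWithinAt_stateFlow θ hs).transpose_mat).congr_deriv ?_
  simp only [gradCurve, Matrix.transpose_mul, Matrix.transpose_neg]
  noncomm_ring

theorem continuousOn_gradCurve {n : ℕ} (θ : ParamSpace n) (G : Mat n) :
    ContinuousOn (gradCurve θ G) (Icc 0 1) :=
  fun _ hs => (hasDerivWithinAt_gradCurve θ G hs).continuousWithinAt

theorem continuousOn_gradCurve_deriv {n : ℕ} (θ : ParamSpace n) (G : Mat n) :
    ContinuousOn (fun s => gradCurve θ G s * (path θ s)ᵀ - (path θ s)ᵀ * gradCurve θ G s)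
      (Icc 0 1) :=
  have hA := (continuous_path θ).matrix_transpose.continuousOn (s := Icc 0 1)
  ((continuousOn_gradCurve θ G).mul hA).sub (hA.mul (continuousOn_gradCurve θ G))

/-- `gradCurve` as an element of the parameter space. -/
noncomputable def gradParam {n : ℕ} (θ : ParamSpace n) (G : Mat n) : ParamSpace n :=
  ParamSpace.ofDeriv _ _ (fun _ hs => hasDerivWithinAt_gradCurve θ G hs)
    (continuousOn_gradCurve_deriv θ G)

theorem path_gradParam {n : ℕ} (θ : ParamSpace n) (G : Mat n) {s : ℝ} (hs : s ∈ Icc (0 : ℝ) 1) :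
    path (gradParam θ G) s = gradCurve θ G s := path_ofDeriv _ _ hs

theorem pathDeriv_gradParam {n : ℕ} (θ : ParamSpace n) (G : Mat n) {s : ℝ}
    (hs : s ∈ Icc (0 : ℝ) 1) :
    pathDeriv (gradParam θ G) s =
      gradCurve θ G s * (path θ s)ᵀ - (path θ s)ᵀ * gradCurve θ G s :=
  pathDeriv_ofDeriv _ _ hs

/-- `B ↦ tr(Gᵀ B)` as a continuous linear map. -/
noncomputable def traceCLM {n : ℕ} (G : Mat n) : Mat n →L[ℝ] ℝ :=
  LinearMap.toContinuousLinearMap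
    ((Matrix.traceLinearMap (Fin n) ℝ ℝ).comp (LinearMap.mulLeft ℝ Gᵀ))

theorem traceCLM_apply {n : ℕ} (G B : Mat n) : traceCLM G B = (Gᵀ * B).trace := rfl

theorem trace_mul_endpointDeriv {n : ℕ} (θ η : ParamSpace n) (G : Mat n) :
    (Gᵀ * endpointDeriv θ η).trace =
      ∫ s in (0 : ℝ)..1, ((path (gradParam θ G) s)ᵀ * path η s).trace := by
  rw [endpointDeriv_apply]
  refine Eq.trans ?_ ((ContinuousLinearMap.intervalIntegral_comp_comm
    (traceCLM ((stateFlow θ 1)ᵀ * G)) (intervalIntegrable_of_continuousOn_unit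
      (continuousOn_sensitivity θ η θ))).symm.trans
        (intervalIntegral.integral_congr fun s hs => ?_))
  · rw [traceCLM_apply, Matrix.transpose_mul, Matrix.transpose_transpose, mul_assoc]
  · rw [uIcc_of_le zero_le_one] at hs
    simp only [traceCLM_apply, path_gradParam θ G hs, gradCurve, Matrix.transpose_mul,
      Matrix.transpose_transpose]
    rw [← mul_assoc, Matrix.trace_mul_comm]
    simp only [mul_assoc]

theorem continuous_trace_mul {n : ℕ} {F H : ℝ → Mat n} (hF : Continuous F) (hH : Continuous H) :
    Continuous fun s => ((F s)ᵀ * H s).trace :=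
  (hF.matrix_transpose.mul hH).matrix_trace

theorem trace_transpose_mul_self_nonneg {n : ℕ} (B : Mat n) : 0 ≤ (Bᵀ * B).trace := by
  rw [← Matrix.conjTranspose_eq_transpose_of_trivial]
  exact (Matrix.posSemidef_conjTranspose_mul_self B).trace_nonneg

/-- The `L²`-gradient is determined by the differential. -/
theorem eq_of_forall_integral_trace_eq {n : ℕ} {g k : ParamSpace n}
    (h : ∀ η : ParamSpace n, ∫ s in (0 : ℝ)..1, ((path g s)ᵀ * path η s).trace =
      ∫ s in (0 : ℝ)..1, ((path k s)ᵀ * path η s).trace) : g = k := by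
  have hint : ∀ p q : ParamSpace n, IntervalIntegrable
      (fun s => ((path p s)ᵀ * path q s).trace) volume 0 1 := fun p q =>
    (continuous_trace_mul (continuous_path p) (continuous_path q)).intervalIntegrable 0 1
  have h0 : ∫ s in (0 : ℝ)..1, ((path (g - k) s)ᵀ * path (g - k) s).trace = 0 := by
    -- Testing against `η = g - k` makes the integral of a nonnegative continuous function vanish.
    have := sub_eq_zero.mpr (h (g - k))
    rw [← intervalIntegral.integral_sub (hint _ _) (hint _ _)] at this
    simpa only [path_sub, Matrix.transpose_sub, sub_mul, Matrix.trace_sub] using this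
  refine ParamSpace.ext_path fun s hs => ?_
  by_contra hne
  have hpos : 0 < ((path (g - k) s)ᵀ * path (g - k) s).trace := by
    refine lt_of_le_of_ne (trace_transpose_mul_self_nonneg _) fun h => hne ?_
    rw [← Matrix.conjTranspose_eq_transpose_of_trivial, eq_comm,
      Matrix.trace_conjTranspose_mul_self_eq_zero_iff, path_sub, sub_eq_zero] at h
    exact h
  exact (intervalIntegral.integral_pos zero_lt_one
    (continuous_trace_mul (continuous_path _) (continuous_path _)).continuousOn
    (fun u _ => trace_transpose_mul_self_nonneg _) ⟨s, hs, hpos⟩).ne' h0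

/-- The chain rule through the end point. -/
theorem HasL2Gradient.eq_gradParam {n : ℕ} {f : Mat n → ℝ} {θ g : ParamSpace n}
    (hf : DifferentiableAt ℝ f (stateFlow θ 1)) (hg : HasL2Gradient (loss f) θ g) :
    g = gradParam θ (matGrad f (stateFlow θ 1)) := by
  obtain ⟨D, hD, hDg⟩ := hg
  have hcomp : HasFDerivAt (E := ParamSpace n) (loss f)
      ((fderiv ℝ f (stateFlow θ 1)).comp (endpointDeriv θ)) θ := by
    have h := HasFDerivAt.comp (E := ParamSpace n) (F := Mat n) (G := ℝ) (g := f)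
      (f := fun φ : ParamSpace n => stateFlow φ 1) (f' := endpointDeriv θ) θ hf.hasFDerivAt
      (hasFDerivAt_endpoint θ)
    exact h
  have hD' : D = (fderiv ℝ f (stateFlow θ 1)).comp (endpointDeriv θ) := by
    have h := HasFDerivAt.unique (E := ParamSpace n) (F := ℝ) hD hcomp
    exact h
  refine eq_of_forall_integral_trace_eq fun η => ?_
  rw [← hDg, ← trace_mul_endpointDeriv, ← fderiv_apply_eq_trace, hD']
  rfl

/-! ### Conservation of `h_s` in time. -/

theorem convex_timeInterval (T : EReal) : Convex ℝ (timeInterval T) := by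
  refine Set.OrdConnected.convex ⟨fun x hx y hy z hz => ⟨hx.1.trans hz.1, ?_⟩⟩
  exact lt_of_le_of_lt (EReal.coe_le_coe_iff.mpr hz.2) hy.2

theorem IsGradientFlow.hasDerivWithinAt {n : ℕ} {f : Mat n → ℝ} (hf : Differentiable ℝ f)
    {T : EReal} {θ : ℝ → ParamSpace n} (hθ : IsGradientFlow (loss f) T θ) {t : ℝ}
    (ht : t ∈ timeInterval T) :
    HasDerivWithinAt θ (-gradParam (θ t) (matGrad f (stateFlow (θ t) 1))) (timeInterval T) t := by
  obtain ⟨g, hg, hd⟩ := hθ t ht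
  rwa [hg.eq_gradParam (hf _)] at hd

theorem hasDerivWithinAt_clm_comp {E F : Type*} [NormedAddCommGroup E] [NormedSpace ℝ E]
    [NormedAddCommGroup F] [NormedSpace ℝ F] (D : E →L[ℝ] F) {c : ℝ → E} {c' : E} {S : Set ℝ}
    {t : ℝ} (h : HasDerivWithinAt c c' S t) :
    HasDerivWithinAt (fun τ => D (c τ)) (D c') S t :=
  D.hasFDerivAt.comp_hasDerivWithinAt t h

/-- The matrices `h_s` are conserved along the gradient flow. -/
theorem IsGradientFlow.conserved_eq {n : ℕ} {f : Mat n → ℝ} (hf : Differentiable ℝ f)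
    {T : EReal} (hT : 0 < T) {θ : ℝ → ParamSpace n} (hθ : IsGradientFlow (loss f) T θ)
    {s : ℝ} (hs : s ∈ Icc (0 : ℝ) 1) {t : ℝ} (ht : t ∈ timeInterval T) :
    conserved s (θ t) = conserved s (θ 0) := by
  refine eq_of_hasDerivWithinAt_zero (convex_timeInterval T)
    (F := fun τ => conserved s (θ τ)) (fun τ hτ => ?_) ⟨le_rfl, by simpa using hT⟩ ht
  have hd := hθ.hasDerivWithinAt hf hτ
  set g := gradParam (θ τ) (matGrad f (stateFlow (θ τ) 1))
  have h1 : HasDerivWithinAt (fun τ => path (θ τ) s) (-path g s) (timeInterval T) τ := by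
    have := hasDerivWithinAt_clm_comp (E := ParamSpace n) (F := Mat n) (pathCLM s) hd
    exact this
  have h2 : HasDerivWithinAt (fun τ => pathDeriv (θ τ) s) (-pathDeriv g s) (timeInterval T) τ := by
    have := hasDerivWithinAt_clm_comp (E := ParamSpace n) (F := Mat n) (pathDerivCLM s) hd
    exact this
  have h1t := h1.transpose_mat
  refine ((h2.add h2.transpose_mat).add ((h1t.mul h1).sub (h1.mul h1t))).congr_deriv ?_
  -- Since `g' = -[Aᵀ, g]` and `g'ᵀ = -[gᵀ, A]`, the first two terms cancel the variation of `[Aᵀ,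
  -- A]`.
  rw [pathDeriv_gradParam _ _ hs, path_gradParam _ _ hs]
  simp only [Matrix.transpose_neg, Matrix.transpose_sub, Matrix.transpose_mul,
    Matrix.transpose_transpose]
  noncomm_ring

/-! ### Relaxed balancedness and the closed form of `Z_sᵀ Z_s`. -/

/-- Because `-[Aᵀ, A] = [A, A + Aᵀ]`, balancedness is a Lax equation for `A + Aᵀ` with scalar
forcing. -/
theorem symm_path_hasDerivWithinAt {n : ℕ} {θ : ParamSpace n} {c s : ℝ}
    (hs : s ∈ Icc (0 : ℝ) 1) (h : conserved s θ = c • (1 : Mat n)) :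
    HasDerivWithinAt (fun u => path θ u + (path θ u)ᵀ)
      (c • 1 + path θ s * (path θ s + (path θ s)ᵀ) - (path θ s + (path θ s)ᵀ) * path θ s)
      (Icc 0 1) s := by
  have hd := hasDerivWithinAt_path θ hs
  refine (hd.add hd.transpose_mat).congr_deriv ?_
  rw [← h, conserved, Ring.lie_def]
  noncomm_ring

/-- Conjugating by the flow cancels the commutator and leaves the scalar forcing, which integrates
directly. -/
theorem stateInv_mul_symm_path_mul_stateFlow {n : ℕ} {θ : ParamSpace n} {L : ℝ → ℝ}
    (hL : Continuous L)
    (h : ∀ s ∈ Icc (0 : ℝ) 1, conserved s θ = L s • (1 : Mat n)) {s : ℝ}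
    (hs : s ∈ Icc (0 : ℝ) 1) :
    stateInv θ s * (path θ s + (path θ s)ᵀ) * stateFlow θ s =
      path θ 0 + (path θ 0)ᵀ + (∫ v in (0 : ℝ)..s, L v) • (1 : Mat n) := by
  have hd : ∀ u ∈ Icc (0 : ℝ) 1, HasDerivWithinAt (fun u =>
      stateInv θ u * (path θ u + (path θ u)ᵀ) * stateFlow θ u -
        (∫ v in (0 : ℝ)..u, L v) • (1 : Mat n)) 0 (Icc 0 1) u := fun u hu => by
    refine ((((hasDerivWithinAt_stateInv θ hu).mul
      (symm_path_hasDerivWithinAt hu (h u hu))).mul (hasDerivWithinAt_stateFlow θ hu)).sub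
        ((hasDerivAt_primitive hL u).hasDerivWithinAt.smul_const (1 : Mat n))).congr_deriv ?_
    have h1 : L u • (1 : Mat n) = stateInv θ u * (L u • 1) * stateFlow θ u := by
      rw [mul_smul_comm, mul_one, smul_mul_assoc, stateInv_mul_stateFlow θ hu]
    nth_rewrite 2 [h1]
    simp only [Pi.mul_apply]
    noncomm_ring
  have := eq_of_hasDerivWithinAt_zero (convex_Icc (0 : ℝ) 1) hd
    (left_mem_Icc.mpr zero_le_one) hs
  simp only [stateInv_zero, stateFlow_zero, one_mul, mul_one, intervalIntegral.integral_same,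
    zero_smul, sub_zero] at this
  exact sub_eq_iff_eq_add.mp this

/-- `Z_sᵀ Z_s = exp(s (A_0 + A_0ᵀ) + ψ₂(s))`. -/
theorem transpose_stateFlow_mul_stateFlow {n : ℕ} {θ : ParamSpace n} {L : ℝ → ℝ}
    (hL : Continuous L)
    (h : ∀ s ∈ Icc (0 : ℝ) 1, conserved s θ = L s • (1 : Mat n)) {s : ℝ}
    (hs : s ∈ Icc (0 : ℝ) 1) :
    (stateFlow θ s)ᵀ * stateFlow θ s =
      Real.exp (psi₂ L s) • NormedSpace.exp (s • (path θ 0 + (path θ 0)ᵀ)) := by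
  set S := path θ 0 + (path θ 0)ᵀ with hS
  have hG : ∀ u ∈ Icc (0 : ℝ) 1, HasDerivWithinAt (fun u => (stateFlow θ u)ᵀ * stateFlow θ u)
      ((stateFlow θ u)ᵀ * stateFlow θ u * (S + (∫ v in (0 : ℝ)..u, L v) • (1 : Mat n)))
      (Icc 0 1) u := fun u hu => by
    refine ((hasDerivWithinAt_stateFlow θ hu).transpose_mat.mul
      (hasDerivWithinAt_stateFlow θ hu)).congr_deriv ?_
    rw [← stateInv_mul_symm_path_mul_stateFlow hL h hu, Matrix.transpose_mul]
    simp only [← mul_assoc]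
    rw [mul_assoc _ (stateFlow θ u) (stateInv θ u), stateFlow_mul_stateInv θ hu]
    noncomm_ring
  -- The inverse of the claimed value serves as integrating factor: multiplied by `ZᵀZ` on the left,
  -- it gives a constant.
  have hE : ∀ u : ℝ, HasDerivAt (fun u => Real.exp (-psi₂ L u) • NormedSpace.exp (u • -S))
      (-((S + (∫ v in (0 : ℝ)..u, L v) • (1 : Mat n)) *
        Real.exp (-psi₂ L u) • NormedSpace.exp (u • -S))) u := fun u => by
    refine ((hasDerivAt_psi₂ hL u).neg.exp.smul
      (hasDerivAt_exp_smul_const' (-S) u)).congr_deriv ?_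
    simp only [add_mul, smul_mul_assoc, mul_smul_comm, one_mul, neg_mul, smul_neg,
      smul_add, smul_smul, Pi.neg_apply, mul_neg, neg_smul, neg_add]
  have hd : ∀ u ∈ Icc (0 : ℝ) 1, HasDerivWithinAt (fun u => ((stateFlow θ u)ᵀ * stateFlow θ u) *
      (Real.exp (-psi₂ L u) • NormedSpace.exp (u • -S))) 0 (Icc 0 1) u := fun u hu =>
    ((hG u hu).mul (hE u).hasDerivWithinAt).congr_deriv (by noncomm_ring)
  have hc := eq_of_hasDerivWithinAt_zero (convex_Icc (0 : ℝ) 1) hd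
    (left_mem_Icc.mpr zero_le_one) hs
  have hinv : (Real.exp (-psi₂ L s) • NormedSpace.exp (s • -S)) *
      (Real.exp (psi₂ L s) • NormedSpace.exp (s • S)) = 1 := by
    rw [smul_mul_smul_comm, ← Real.exp_add, neg_add_cancel, Real.exp_zero, one_smul,
      smul_neg, ← Matrix.exp_add_of_commute _ _ (Commute.refl (s • S)).neg_left,
      neg_add_cancel, NormedSpace.exp_zero]
  simp only [stateFlow_zero, psi₂_zero, Matrix.transpose_one, mul_one, neg_zero, Real.exp_zero,
    zero_smul, NormedSpace.exp_zero, one_smul] at hc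
  calc _ = (stateFlow θ s)ᵀ * stateFlow θ s * ((Real.exp (-psi₂ L s) • NormedSpace.exp (s • -S)) *
      (Real.exp (psi₂ L s) • NormedSpace.exp (s • S))) := by rw [hinv, mul_one]
    _ = _ := by rw [← mul_assoc, hc, one_mul]

/-! ### Real powers at the end point and the integrand. -/

theorem exp_smul_add_smul_one {n : ℕ} (S : Mat n) (r c : ℝ) :
    NormedSpace.exp (r • (S + c • (1 : Mat n))) = Real.exp (r * c) • NormedSpace.exp (r • S) := by
  have h1 : r • c • (1 : Mat n) = algebraMap ℝ (Mat n) (r * c) := by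
    rw [Algebra.algebraMap_eq_smul_one, smul_smul]
  rw [smul_add, h1, Matrix.exp_add_of_commute _ _ (Algebra.commute_algebraMap_right _ _),
    ← NormedSpace.algebraMap_exp_comm, ← Real.exp_eq_exp_ℝ, Algebra.algebraMap_eq_smul_one,
    mul_smul_comm, mul_one]

theorem isSelfAdjoint_mat_iff {n : ℕ} {B : Mat n} : IsSelfAdjoint B ↔ Bᵀ = B := by
  rw [IsSelfAdjoint, Matrix.star_eq_conjTranspose, Matrix.conjTranspose_eq_transpose_of_trivial]

theorem exp_smul_conj {n : ℕ} {Z W H : Mat n} (hZW : Z * W = 1) (r : ℝ) :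
    NormedSpace.exp (r • (Z * H * W)) = Z * NormedSpace.exp (r • H) * W := by
  have h := Matrix.exp_units_conj ⟨Z, W, hZW, mul_eq_one_comm.mp hZW⟩ (r • H)
  rw [← smul_mul_assoc, ← mul_smul_comm]
  exact h

/-- If `Zᵀ Z = exp H` and `Z H Z⁻¹` is symmetric, then `(Z Zᵀ)^r = Z exp(r H) Z⁻¹`. -/
theorem rpow_mul_transpose {n : ℕ} {Z W H : Mat n} (hZW : Z * W = 1)
    (hP : Zᵀ * Z = NormedSpace.exp H) (hK : IsSelfAdjoint (Z * H * W)) (r : ℝ) :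
    (Z * Zᵀ) ^ r = Z * NormedSpace.exp (r • H) * W := by
  have h1 : Z * Zᵀ = NormedSpace.exp (Z * H * W) := by
    have := exp_smul_conj (H := H) hZW 1
    rw [one_smul, one_smul] at this
    rw [this, ← hP, mul_assoc, mul_assoc, hZW, mul_one]
  rw [h1, rpow_exp hK, exp_smul_conj hZW]

theorem intrinsicIntegrand_eq {n : ℕ} {θ : ParamSpace n} {lam : ℝ → ℝ}
    (hlam : ContinuousOn lam (Icc 0 1))
    (h : ∀ s ∈ Icc (0 : ℝ) 1, conserved s θ = lam s • (1 : Mat n)) (f : Mat n → ℝ) {s : ℝ}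
    (hs : s ∈ Icc (0 : ℝ) 1) :
    intrinsicIntegrand f lam (stateFlow θ 1) s = stateFlow θ 1 *
      (stateInv θ s * gradCurve θ (matGrad f (stateFlow θ 1)) s * stateFlow θ s) := by
  obtain ⟨L, hL, hEq⟩ : ∃ L : ℝ → ℝ, Continuous L ∧ EqOn L lam (Icc 0 1) :=
    ⟨IccExtend (zero_le_one' ℝ) ((Icc 0 1).domRestrict lam), hlam.domRestrict.Icc_extend',
      fun v hv => by rw [IccExtend_of_mem _ _ hv]; rfl⟩
  have hLc : ∀ u ∈ Icc (0 : ℝ) 1, conserved u θ = L u • (1 : Mat n) :=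
    fun u hu => by rw [h u hu, hEq hu]
  have h1 : (1 : ℝ) ∈ Icc (0 : ℝ) 1 := right_mem_Icc.mpr zero_le_one
  rw [intrinsicIntegrand, gammaExponent_eq_zero hlam hs, Real.exp_zero, one_smul, gradCurve]
  set G := matGrad f (stateFlow θ 1)
  set Z := stateFlow θ 1
  set W := stateInv θ 1
  set S := path θ 0 + (path θ 0)ᵀ with hS
  set H := S + psi₂ L 1 • (1 : Mat n) with hH
  have hZW : Z * W = 1 := stateFlow_mul_stateInv θ h1
  have hSs : Sᵀ = S := by
    rw [hS, Matrix.transpose_add, Matrix.transpose_transpose, add_comm]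
  have hHs : IsSelfAdjoint H := by
    rw [isSelfAdjoint_mat_iff, hH, Matrix.transpose_add, hSs, Matrix.transpose_smul,
      Matrix.transpose_one]
  have hP : Zᵀ * Z = NormedSpace.exp H := by
    have := exp_smul_add_smul_one S 1 (psi₂ L 1)
    rw [one_smul, one_mul] at this
    rw [this, transpose_stateFlow_mul_stateFlow hL hLc h1]
  -- Read at `s = 1`, the conjugation identity gives `Z S Z⁻¹ = A_1 + A_1ᵀ - ∫₀¹ L`, which is
  -- symmetric.
  have hK : IsSelfAdjoint (Z * H * W) := by
    have hS1 := stateInv_mul_symm_path_mul_stateFlow hL hLc h1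
    have hZSW : Z * S * W = path θ 1 + (path θ 1)ᵀ - (∫ v in (0 : ℝ)..1, L v) • (1 : Mat n) := by
      have hS' : S = _ := eq_sub_of_add_eq hS1.symm
      rw [hS', mul_sub, sub_mul, mul_smul_comm, mul_one, smul_mul_assoc,
        hZW]
      simp only [mul_assoc]
      rw [hZW, mul_one, ← mul_assoc, hZW, one_mul]
    rw [isSelfAdjoint_mat_iff, hH, mul_add, add_mul, hZSW, mul_smul_comm, mul_one,
      smul_mul_assoc, hZW]
    simp only [Matrix.transpose_add, Matrix.transpose_sub, Matrix.transpose_smul,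
      Matrix.transpose_one, Matrix.transpose_transpose]
    rw [add_comm (path θ 1)ᵀ]
  -- The mismatch between `Z_sᵀ Z_s = e^{ψ₂(s)} exp(sS)` and `exp(sH) = e^{s ψ₂(1)} exp(sS)`.
  set c := Real.exp (psi₂ L s - s * psi₂ L 1)
  have hPs : (stateFlow θ s)ᵀ * stateFlow θ s = c • NormedSpace.exp (s • H) := by
    rw [transpose_stateFlow_mul_stateFlow hL hLc hs, exp_smul_add_smul_one, smul_smul,
      ← Real.exp_add, sub_add_cancel]
  have hneg : NormedSpace.exp (-(s • H)) = c • (stateInv θ s * (stateInv θ s)ᵀ) := by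
    have h2 : stateFlow θ s * stateInv θ s = 1 := stateFlow_mul_stateInv θ hs
    have h3 : ((stateFlow θ s)ᵀ * stateFlow θ s) * (stateInv θ s * (stateInv θ s)ᵀ) = 1 := by
      rw [mul_assoc, ← mul_assoc (stateFlow θ s), h2, one_mul, ← Matrix.transpose_mul,
        stateInv_mul_stateFlow θ hs, Matrix.transpose_one]
    have h4 : NormedSpace.exp (-(s • H)) * NormedSpace.exp (s • H) = 1 := by
      rw [← Matrix.exp_add_of_commute _ _ (Commute.refl (s • H)).neg_left, neg_add_cancel,
        NormedSpace.exp_zero]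
    rw [← mul_one (NormedSpace.exp _), ← h3, hPs, ← mul_assoc, mul_smul_comm, h4, smul_mul_assoc,
      one_mul]
  have hleft : Z * NormedSpace.exp ((1 - s) • H) * W =
      c • (Z * (stateInv θ s * (stateInv θ s)ᵀ) * Zᵀ) := by
    have h5 : NormedSpace.exp ((1 - s) • H) =
        NormedSpace.exp (-(s • H)) * NormedSpace.exp H := by
      rw [← Matrix.exp_add_of_commute _ _ ((Commute.refl H).smul_left s).neg_left, sub_smul,
        one_smul, neg_add_eq_sub]
    rw [h5, hneg, ← hP, smul_mul_assoc, mul_smul_comm, smul_mul_assoc]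
    simp only [mul_assoc]
    rw [hZW, mul_one]
  -- The scalar `c` from the left power is moved onto `exp(sH)`, where it produces exactly `Z_sᵀ
  -- Z_s`.
  rw [rpow_mul_transpose hZW hP hK, hP, rpow_exp hHs, hleft, smul_mul_assoc, smul_mul_assoc,
    ← mul_smul_comm, ← hPs]
  simp only [mul_assoc]

/-! ### The evolution equation for the end point. -/

theorem mainTheorem6 (n : ℕ) (f : Mat n → ℝ) (hf : ContDiff ℝ 1 f)
    (T : EReal) (hT : 0 < T) (θ : ℝ → ParamSpace n) (hθ : IsGradientFlow (loss f) T θ)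
    (lam : ℝ → ℝ) (hlam : ContinuousOn lam (Icc 0 1))
    (hinit : ∀ s ∈ Icc (0 : ℝ) 1, conserved s (θ 0) = lam s • (1 : Mat n)) :
    (∀ t ∈ timeInterval T,
      IntervalIntegrable (intrinsicIntegrand f lam (stateFlow (θ t) 1)) volume 0 1 ∧
      HasDerivWithinAt (fun τ => stateFlow (θ τ) 1)
        (-∫ s in (0 : ℝ)..1, intrinsicIntegrand f lam (stateFlow (θ t) 1) s)
        (timeInterval T) t) ∧
    ((∀ s ∈ Icc (0 : ℝ) 1, lam s = 0) → ∀ s ∈ Icc (0 : ℝ) 1, gammaExponent lam s = 0) := by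
  have hfd : Differentiable ℝ f := hf.differentiable one_ne_zero
  refine ⟨fun t ht => ?_, fun _ s hs => gammaExponent_eq_zero hlam hs⟩
  have hcons : ∀ s ∈ Icc (0 : ℝ) 1, conserved s (θ t) = lam s • (1 : Mat n) := fun s hs =>
    (hθ.conserved_eq hfd hT hs ht).trans (hinit s hs)
  set g := gradParam (θ t) (matGrad f (stateFlow (θ t) 1)) with hg
  have heq : ∀ s ∈ Icc (0 : ℝ) 1, intrinsicIntegrand f lam (stateFlow (θ t) 1) s =
      stateFlow (θ t) 1 * (stateInv (θ t) s * path g s * stateFlow (θ t) s) := fun s hs => by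
    rw [intrinsicIntegrand_eq hlam hcons f hs, hg, path_gradParam _ _ hs]
  have hc := continuousOn_sensitivity (θ t) g (θ t)
  refine ⟨intervalIntegrable_of_continuousOn_unit
    ((continuousOn_const.mul hc).congr heq), ?_⟩
  have hval : -∫ s in (0 : ℝ)..1, intrinsicIntegrand f lam (stateFlow (θ t) 1) s =
      endpointDeriv (θ t) (-g) := by
    rw [map_neg, endpointDeriv_apply]
    congr 1
    refine Eq.trans (intervalIntegral.integral_congr fun s hs => ?_)
      (ContinuousLinearMap.intervalIntegral_comp_comm
        (ContinuousLinearMap.mul ℝ (Mat n) (stateFlow (θ t) 1))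
        (intervalIntegrable_of_continuousOn_unit hc))
    rw [uIcc_of_le zero_le_one] at hs
    exact heq s hs
  rw [hval]
  have := HasFDerivAt.comp_hasDerivWithinAt (F := ParamSpace n) (E := Mat n)
    (l := fun φ : ParamSpace n => stateFlow φ 1) (l' := endpointDeriv (θ t)) (f := θ) (f' := -g)
    (s := timeInterval T) t (hasFDerivAt_endpoint (θ t)) (hθ.hasDerivWithinAt hfd ht)
  exact this
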